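/- Let $A=[a_{ij}]$ be a symmetric $n\times n$ matrix with entries in $[0,1]$, let $N$ be a positive integer, and let $\mu,\mu'$ be probability measures on $\{1,\dots,n\}$ with $\mu_i,\mu'_i>0$ and $\mu_iN,\mu'_iN\in\mathbb{N}$ for all $i$. Let $\epsilon\ge 0$ and suppose that $\mu'_i=\mu_i(1+\epsilon_i)$ with $|\epsilon_i|\le\epsilon$ for all $i$. Put $A_\mu=[\sqrt{\mu_i\mu_j}\,a_{ij}]_{i,j}$ and $\mu_{\min}=\min_i\mu_i$. Split $\{1,\dots,N\}$ into consecutive intervals $B_1,\dots,B_n$ with $|B_i|=\mu_iN$, and let $W$ be the $N\times N$ matrix (the model matrix of the stochastic block model given by $A,\mu,N$) whose entries on $B_i\times B_j$ all equal $a_{ij}$; let $W'$ be the model matrix defined in the same way from $A,\mu',N$. Index the nonzero eigenvalues of $W$, repeated according to multiplicity, by a set $I\subset\mathbb{Z}\setminus\{0\}$ of the form $\{-q,\dots,-1\}\cup\{1,\dots,p\}$ so that $\lambda_1(W)\ge\lambda_2(W)\ge\dots>0$ and $0>\dots\ge\lambda_{-2}(W)\ge\lambda_{-1}(W)$, and index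 those of $W'$ in the same way by a set $I'$. Let $\{y'_i\}_{i\in I'}\subset\mathbb{C}^N$ be any orthonormal family of eigenvectors of $W'$ with $W'y'_i=\lambda_i(W')y'_i$. Let $\lambda$ be a nonzero eigenvalue of $A_\mu$ with multiplicity $d$, and let $\gamma(\lambda)=\min\{|\lambda-\nu|:\nu\ne\lambda\text{ an eigenvalue of }A_\mu\}$, with the convention $\gamma(\lambda)=\infty$, $1/\gamma(\lambda)=0$, if $A_\mu$ has no other eigenvalue. Put $I_\lambda=\{i\in I:\lambda_i(W)=N\lambda\}$. For a signal $x\in\mathbb{C}^N$ let the Fourier projection $\widehat{x}(\lambda)$ be the orthogonal projection of $x$ onto the $N\lambda$-eigenspace of $W$. Then $I_\lambda\subseteq I'$, and for every $x\in\mathbb{C}^N$, $$\Big\|\widehat{x}(\lambda)-\sum_{i\in I_\lambda}\langle x,y'_i\rangle\,y'_i\Big\|\le\left(\frac{2^{5/2}d^{1/2}\|A_\mu\|_{\mathrm{opr}}}{\gamma(\lambda)}\,n\epsilon+\frac{2\sqrt{3}}{\sqrt{\mu_{\min}}}\sqrt{n\epsilon}\right)\|x\|,$$ where $\|\cdot\|$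 is the Euclidean norm on $\mathbb{C}^N$ and $\|\cdot\|_{\mathrm{opr}}$ is the operator norm with respect to the Euclidean norm. In particular, the constant in the bound does not depend on $N$. -/

import Mathlib

open scoped ENNReal

noncomputable section

namespace SBM

/-- A probability measure `μ` on `[n]` with full support, such that every block size
`μ i * N` is a natural number; `size i` is that number. -/
structure BlockMeasure (n N : ℕ) where
  /-- the fraction of the vertices in each block -/
  μ : Fin n → ℝ
  /-- the number of vertices in each block -/
  size : Fin n → ℕ
  μ_pos : ∀ i, 0 < μ i
  μ_sum : ∑ i, μ i = 1
  size_eq : ∀ i, (size i : ℝ) = μ i * N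

theorem BlockMeasure.sum_size {n N : ℕ} (b : BlockMeasure n N) : ∑ i, b.size i = N := by
  have h : ((∑ i, b.size i : ℕ) : ℝ) = (N : ℝ) := by
    push_cast
    simp only [b.size_eq]
    rw [← Finset.sum_mul, b.μ_sum, one_mul]
  exact_mod_cast h

/-- The block that contains the vertex `u`, where the blocks are consecutive intervals of
`Fin N` of lengths `size 0, size 1, …`. -/
def BlockMeasure.blockOf {n N : ℕ} (b : BlockMeasure n N) (u : Fin N) : Fin n :=
  (finSigmaFinEquiv.symm (Fin.cast b.sum_size.symm u)).1

/-- The model matrix `W`, obtained from `A` by replacing each entry `A i j` by a constant block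
of shape `size i × size j`. -/
def modelMatrix {n N : ℕ} (A : Matrix (Fin n) (Fin n) ℝ) (b : BlockMeasure n N) :
    Matrix (Fin N) (Fin N) ℝ :=
  Matrix.of fun u v => A (b.blockOf u) (b.blockOf v)

/-- The weighted probability matrix `√M * A * √M`, where `M = diag(μ)`. -/
def weightedMatrix {n : ℕ} (A : Matrix (Fin n) (Fin n) ℝ) (μ : Fin n → ℝ) :
    Matrix (Fin n) (Fin n) ℝ :=
  Matrix.diagonal (fun i => √(μ i)) * A * Matrix.diagonal (fun i => √(μ i))

/-- The operator on the Hilbert space `ℂ^m` given by a real `m × m` matrix. Its norm is the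
operator norm of the matrix. -/
def op {m : ℕ} (B : Matrix (Fin m) (Fin m) ℝ) :
    EuclideanSpace ℂ (Fin m) →L[ℂ] EuclideanSpace ℂ (Fin m) :=
  Matrix.toEuclideanCLM (𝕜 := ℂ) (B.map (fun t : ℝ => (t : ℂ)))

/-- The eigenspace in `ℂ^m` of a real `m × m` matrix for the real number `lam`. -/
def eigenspace {m : ℕ} (B : Matrix (Fin m) (Fin m) ℝ) (lam : ℝ) :
    Submodule ℂ (EuclideanSpace ℂ (Fin m)) :=
  Module.End.eigenspace (op B : Module.End ℂ (EuclideanSpace ℂ (Fin m))) (lam : ℂ)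

/-- `lam` is an eigenvalue of `B`. -/
def IsEigenvalue {m : ℕ} (B : Matrix (Fin m) (Fin m) ℝ) (lam : ℝ) : Prop :=
  eigenspace B lam ≠ ⊥

/-- The multiplicity of `lam` as an eigenvalue of `B`. -/
def multiplicity {m : ℕ} (B : Matrix (Fin m) (Fin m) ℝ) (lam : ℝ) : ℕ :=
  Module.finrank ℂ (eigenspace B lam)

/-- The distance from `lam` to the other eigenvalues of `B` (zero included, if it is one);
it is `∞` if `B` has no other eigenvalue. Only symmetric matrices are considered, whose
eigenvalues are all real. -/
def spectralGap {m : ℕ} (B : Matrix (Fin m) (Fin m) ℝ) (lam : ℝ) : ℝ≥0∞ :=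
  ⨅ ν ∈ {ν : ℝ | IsEigenvalue B ν ∧ ν ≠ lam}, ENNReal.ofReal |lam - ν|

/-- The Fourier projection `x̂(lam)` of the signal `x`, where eigenvalues are
normalized as those of `A_μ`: the eigenvalue `lam` of `A_μ` corresponds to the eigenvalue
`N * lam` of the model matrix, and `x` is projected orthogonally onto its eigenspace. -/
def fourierProjection {n N : ℕ} (A : Matrix (Fin n) (Fin n) ℝ) (b : BlockMeasure n N)
    (lam : ℝ) (x : EuclideanSpace ℂ (Fin N)) : EuclideanSpace ℂ (Fin N) :=
  (eigenspace (modelMatrix A b) (N * lam)).starProjection x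

/-- `y` is an orthonormal family of eigenvectors of the symmetric matrix `B`, for its nonzero
eigenvalues `ev` repeated according to multiplicity, indexed by `I ⊆ ℤ \ {0}` so that
`ev 1 ≥ ev 2 ≥ … > 0` and `0 > … ≥ ev (-2) ≥ ev (-1)`. -/
structure IsOrderedEigensystem {m : ℕ} (B : Matrix (Fin m) (Fin m) ℝ) (I : Finset ℤ)
    (ev : ℤ → ℝ) (y : ℤ → EuclideanSpace ℂ (Fin m)) : Prop where
  index : ∃ p q : ℕ, I = Finset.Icc (-(q : ℤ)) (-1) ∪ Finset.Icc 1 (p : ℤ)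
  pos : ∀ i ∈ I, 0 < i → 0 < ev i
  neg : ∀ i ∈ I, i < 0 → ev i < 0
  antitone_pos : ∀ i ∈ I, ∀ j ∈ I, 0 < i → i ≤ j → ev j ≤ ev i
  antitone_neg : ∀ i ∈ I, ∀ j ∈ I, j < 0 → i ≤ j → ev j ≤ ev i
  orthonormal : Orthonormal ℂ (fun i : I => y i)
  eigen : ∀ i ∈ I, op B (y i) = (ev i : ℂ) • y i
  /-- All nonzero eigenvalues are listed with full multiplicity. -/
  complete : ∀ v, (∀ i ∈ I, inner ℂ (y i) v = 0) → op B v = 0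

end SBM

end

/-! Let `J : ℂ^n → ℂ^N` be the isometry onto the vectors that are constant on the blocks of `μ`.
Then `W J = N • J A_μ`, and `W` vanishes on the orthogonal complement of the range of `J`. So
eigenvectors of `W` for nonzero eigenvalues have the form `J z` with `z` an eigenvector of `A_μ`,
and the Fourier projection is `J P J*`, where `P` is the spectral projection of `A_μ` at `lam`. With
`J'`, `P'` for `μ'`, the difference `J P J* - J' P' J'*` splits into a part governed by `P - P'` and
two parts of norm at most `‖J - J'‖`. Only the first part involves spectra, and it lives in `ℂ^n`,
hence the independence of `N`.

For `P - P'`: `A_μ'` is congruent to `A_μ` by the diagonal matrix of `√(1 + e i)`. Sylvester's law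
of inertia gives `I ⊆ I'`, and the congruence gives `‖A_μ - A_μ'‖ ≤ 2ε‖A_μ‖` for small `ε`. By
Weyl's inequality each `z'_i` is an approximate eigenvector of `A_μ` for `lam`, so the gap bounds
its distance from the eigenspace; an argument of Davis–Kahan type turns this into a bound on the
projections.

For `‖J - J'‖`: the two intervals that form block `i` for `μ` and `μ'` overlap in all but a small
proportion, so `J` and `J'` nearly agree on each basis vector. -/

namespace SBM

/-! ### Comparing the projections given by two orthonormal families -/

section FourierSum

variable {ι E F : Type*} [Fintype ι] [NormedAddCommGroup E] [InnerProductSpace ℂ E]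
  [NormedAddCommGroup F] [InnerProductSpace ℂ F]

/-- The sum `∑ i, ⟪v i, x⟫ • v i`; the orthogonal projection onto the span of `v` if `v` is
orthonormal. -/
noncomputable def fourierSum (v : ι → E) : E →ₗ[ℂ] E :=
  ∑ i, (innerₛₗ ℂ (v i)).smulRight (v i)

theorem fourierSum_apply (v : ι → E) (x : E) :
    fourierSum v x = ∑ i, (inner ℂ (v i) x : ℂ) • v i := by
  simp [fourierSum, LinearMap.sum_apply]

theorem inner_fourierSum_right {v : ι → E} (hv : Orthonormal ℂ v) (j : ι) (x : E) :
    (inner ℂ (v j) (fourierSum v x) : ℂ) = inner ℂ (v j) x := by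
  rw [fourierSum_apply]
  exact hv.inner_right_fintype _ j

theorem inner_fourierSum_comm (v : ι → E) (x y : E) :
    (inner ℂ (fourierSum v x) y : ℂ) = inner ℂ x (fourierSum v y) := by
  simp only [fourierSum_apply, sum_inner, inner_sum, inner_smul_left, inner_smul_right]
  refine Finset.sum_congr rfl fun i _ => ?_
  rw [inner_conj_symm, mul_comm]

theorem inner_fourierSum_sub {v : ι → E} (hv : Orthonormal ℂ v) (x y : E) :
    (inner ℂ (fourierSum v x) (y - fourierSum v y) : ℂ) = 0 := by
  rw [fourierSum_apply, sum_inner]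
  refine Finset.sum_eq_zero fun i _ => ?_
  rw [inner_smul_left, inner_sub_right, inner_fourierSum_right hv, sub_self, mul_zero]

theorem norm_sq_sum_smul {v : ι → E} (hv : Orthonormal ℂ v) (c : ι → ℂ) :
    ‖∑ i, c i • v i‖ ^ 2 = ∑ i, ‖c i‖ ^ 2 := by
  have h : ((‖∑ i, c i • v i‖ ^ 2 : ℝ) : ℂ) = ((∑ i, ‖c i‖ ^ 2 : ℝ) : ℂ) := by
    push_cast
    rw [← Complex.coe_algebraMap, ← inner_self_eq_norm_sq_to_K (𝕜 := ℂ), hv.inner_sum]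
    exact Finset.sum_congr rfl fun i _ => Complex.conj_mul' _
  exact_mod_cast h

theorem norm_sq_fourierSum {v : ι → E} (hv : Orthonormal ℂ v) (x : E) :
    ‖fourierSum v x‖ ^ 2 = ∑ i, ‖(inner ℂ (v i) x : ℂ)‖ ^ 2 := by
  rw [fourierSum_apply, norm_sq_sum_smul hv]

theorem norm_add_sq_of_inner_eq_zero {x y : E} (h : (inner ℂ x y : ℂ) = 0) :
    ‖x + y‖ ^ 2 = ‖x‖ ^ 2 + ‖y‖ ^ 2 := by
  simpa only [sq] using norm_add_sq_eq_norm_sq_add_norm_sq_of_inner_eq_zero (𝕜 := ℂ) x y h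

theorem norm_sq_eq_fourierSum_add {v : ι → E} (hv : Orthonormal ℂ v) (x : E) :
    ‖x‖ ^ 2 = ‖fourierSum v x‖ ^ 2 + ‖x - fourierSum v x‖ ^ 2 := by
  rw [← norm_add_sq_of_inner_eq_zero (inner_fourierSum_sub hv x x), add_sub_cancel]

theorem norm_fourierSum_le {v : ι → E} (hv : Orthonormal ℂ v) (x : E) :
    ‖fourierSum v x‖ ≤ ‖x‖ := by
  have := norm_sq_eq_fourierSum_add hv x
  exact abs_le_of_sq_le_sq' (by nlinarith [sq_nonneg ‖x - fourierSum v x‖]) (norm_nonneg _) |>.2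

theorem norm_sum_smul_sq_le (c : ι → ℂ) (w : ι → F) :
    ‖∑ i, c i • w i‖ ^ 2 ≤ (∑ i, ‖c i‖ ^ 2) * ∑ i, ‖w i‖ ^ 2 := by
  calc ‖∑ i, c i • w i‖ ^ 2 ≤ (∑ i, ‖c i‖ * ‖w i‖) ^ 2 := by
        gcongr
        exact (norm_sum_le _ _).trans_eq (by simp [norm_smul])
    _ ≤ _ := Finset.sum_mul_sq_le_sq_mul_sq _ _ _

/-- Two orthonormal families of the same size have the same total squared distance from the
span of the other one. -/
theorem sum_norm_sub_fourierSum_comm {v w : ι → E} (hv : Orthonormal ℂ v)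
    (hw : Orthonormal ℂ w) :
    ∑ i, ‖v i - fourierSum w (v i)‖ ^ 2 = ∑ i, ‖w i - fourierSum v (w i)‖ ^ 2 := by
  have key : ∀ {v w : ι → E}, Orthonormal ℂ v → Orthonormal ℂ w →
      ∑ i, ‖v i - fourierSum w (v i)‖ ^ 2
        = Fintype.card ι - ∑ i, ∑ j, ‖(inner ℂ (w j) (v i) : ℂ)‖ ^ 2 := by
    intro v w hv hw
    rw [eq_sub_iff_add_eq, ← Finset.sum_add_distrib]
    have : ∀ i, ‖v i - fourierSum w (v i)‖ ^ 2 + ∑ j, ‖(inner ℂ (w j) (v i) : ℂ)‖ ^ 2 = 1 := by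
      intro i
      rw [← norm_sq_fourierSum hw, add_comm, ← norm_sq_eq_fourierSum_add hw, hv.1 i, one_pow]
    simp [this]
  rw [key hv hw, key hw hv, Finset.sum_comm]
  simp only [norm_inner_symm]

/-- With `P`, `Q` the projections for `v`, `w`, write `P - Q = P(1 - Q) - (1 - P)Q`. The two terms
have orthogonal values, so their squared norms add. Each is at most the sum on the right times `‖x‖
^ 2`; for the first this needs the symmetry of that sum in `v` and `w`. -/
theorem norm_fourierSum_sub_sq_le {v w : ι → E} (hv : Orthonormal ℂ v) (hw : Orthonormal ℂ w)
    (x : E) :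
    ‖fourierSum v x - fourierSum w x‖ ^ 2
      ≤ 2 * (∑ i, ‖w i - fourierSum v (w i)‖ ^ 2) * ‖x‖ ^ 2 := by
  set S := ∑ i, ‖w i - fourierSum v (w i)‖ ^ 2 with hS
  have hS0 : 0 ≤ S := by positivity
  have h1 : ‖fourierSum w x - fourierSum v (fourierSum w x)‖ ^ 2 ≤ S * ‖x‖ ^ 2 := by
    have : fourierSum w x - fourierSum v (fourierSum w x)
        = ∑ i, (inner ℂ (w i) x : ℂ) • (w i - fourierSum v (w i)) := by
      simp only [smul_sub, Finset.sum_sub_distrib]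
      rw [fourierSum_apply w x, map_sum]
      simp
    rw [this, mul_comm]
    refine (norm_sum_smul_sq_le _ _).trans ?_
    rw [← norm_sq_fourierSum hw]
    gcongr
    exact norm_fourierSum_le hw x
  have h2 : ‖fourierSum v (x - fourierSum w x)‖ ^ 2 ≤ S * ‖x‖ ^ 2 := by
    rw [norm_sq_fourierSum hv, hS, ← sum_norm_sub_fourierSum_comm hv hw, Finset.sum_mul]
    refine Finset.sum_le_sum fun i _ => ?_
    rw [← mul_pow]
    gcongr
    rw [inner_sub_right, ← inner_fourierSum_comm, ← inner_sub_left]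
    exact norm_inner_le_norm _ _
  have h3 : fourierSum v x - fourierSum w x = fourierSum v (x - fourierSum w x)
      + -(fourierSum w x - fourierSum v (fourierSum w x)) := by
    rw [map_sub]; abel
  have h4 : ‖fourierSum v x - fourierSum w x‖ ^ 2 = ‖fourierSum v (x - fourierSum w x)‖ ^ 2
      + ‖fourierSum w x - fourierSum v (fourierSum w x)‖ ^ 2 := by
    rw [h3, norm_add_sq_of_inner_eq_zero, norm_neg]
    rw [inner_neg_right, inner_fourierSum_sub hv, neg_zero]
  linarith

theorem norm_fourierSum_sub_le {v w : ι → E} (hv : Orthonormal ℂ v) (hw : Orthonormal ℂ w)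
    {τ : ℝ} (hτ0 : 0 ≤ τ) (hτ : ∀ i, ‖w i - fourierSum v (w i)‖ ≤ τ) (x : E) :
    ‖fourierSum v x - fourierSum w x‖ ≤ √2 * √(Fintype.card ι) * τ * ‖x‖ := by
  refine abs_le_of_sq_le_sq' ?_ (by positivity) |>.2
  have hs : ∑ i, ‖w i - fourierSum v (w i)‖ ^ 2 ≤ Fintype.card ι * τ ^ 2 := by
    calc _ ≤ ∑ _i : ι, τ ^ 2 := Finset.sum_le_sum fun i _ => by gcongr; exact hτ i
      _ = _ := by simp
  calc _ ≤ _ := norm_fourierSum_sub_sq_le hv hw x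
    _ ≤ 2 * (Fintype.card ι * τ ^ 2) * ‖x‖ ^ 2 := by gcongr
    _ = _ := by
      rw [mul_pow, mul_pow, mul_pow, Real.sq_sqrt (by norm_num), Real.sq_sqrt (by positivity)]
      ring

end FourierSum

theorem op_neg {m : ℕ} (B : Matrix (Fin m) (Fin m) ℝ) : op (-B) = -op B := by
  rw [op, op, ← map_neg]
  congr 1
  ext i j
  simp

theorem mem_eigenspace {m : ℕ} {B : Matrix (Fin m) (Fin m) ℝ} {lam : ℝ}
    {v : EuclideanSpace ℂ (Fin m)} : v ∈ eigenspace B lam ↔ op B v = (lam : ℂ) • v := by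
  rw [eigenspace, Module.End.mem_eigenspace_iff]
  rfl

/-! ### Spectral decomposition, gap estimate and min-max for ordered eigensystems -/

namespace IsOrderedEigensystem

variable {m m' : ℕ} {B : Matrix (Fin m) (Fin m) ℝ} {B' : Matrix (Fin m') (Fin m') ℝ}
  {I I' : Finset ℤ} {ev ev' : ℤ → ℝ} {y : ℤ → EuclideanSpace ℂ (Fin m)}
  {y' : ℤ → EuclideanSpace ℂ (Fin m')}

theorem zero_notMem (hy : IsOrderedEigensystem B I ev y) : (0 : ℤ) ∉ I := by
  obtain ⟨p, q, rfl⟩ := hy.index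
  simp

theorem ev_ne_zero (hy : IsOrderedEigensystem B I ev y) {i : ℤ} (hi : i ∈ I) : ev i ≠ 0 := by
  rcases lt_trichotomy i 0 with h | h | h
  · exact (hy.neg i hi h).ne
  · exact absurd (h ▸ hi) hy.zero_notMem
  · exact (hy.pos i hi h).ne'

theorem mem_of_le (hy : IsOrderedEigensystem B I ev y) {i k : ℤ} (hk : k ∈ I) (hi : 0 < i)
    (hik : i ≤ k) : i ∈ I := by
  obtain ⟨p, q, rfl⟩ := hy.index
  simp only [Finset.mem_union, Finset.mem_Icc] at hk ⊢
  omega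

/-- Reduces statements about negative indices to positive ones. -/
theorem neg_system (hy : IsOrderedEigensystem B I ev y) :
    IsOrderedEigensystem (-B) (I.map (Equiv.neg ℤ).toEmbedding) (fun i => -ev (-i))
      (fun i => y (-i)) := by
  have hmem : ∀ {i : ℤ}, i ∈ I.map (Equiv.neg ℤ).toEmbedding ↔ -i ∈ I := by
    intro i
    rw [Finset.mem_map_equiv]
    rfl
  refine ⟨?_, ?_, ?_, ?_, ?_, ?_, ?_, ?_⟩
  · obtain ⟨p, q, hpq⟩ := hy.index
    refine ⟨q, p, ?_⟩
    ext i
    rw [hmem, hpq]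
    simp only [Finset.mem_union, Finset.mem_Icc]
    omega
  · intro i hi h
    linarith [hy.neg _ (hmem.1 hi) (by omega)]
  · intro i hi h
    linarith [hy.pos _ (hmem.1 hi) (by omega)]
  · intro i hi j hj h hij
    linarith [hy.antitone_neg _ (hmem.1 hj) _ (hmem.1 hi) (by omega) (by omega)]
  · intro i hi j hj h hij
    linarith [hy.antitone_pos _ (hmem.1 hj) _ (hmem.1 hi) (by omega) (by omega)]
  · exact hy.orthonormal.comp
      (fun i : (I.map (Equiv.neg ℤ).toEmbedding : Finset ℤ) => (⟨-i, hmem.1 i.2⟩ : I))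
      (fun i j h => Subtype.ext (neg_injective (congrArg Subtype.val h)))
  · intro i hi
    rw [op_neg, _root_.neg_apply, hy.eigen _ (hmem.1 hi)]
    simp
  · intro v hv
    rw [op_neg, _root_.neg_apply, hy.complete v, neg_zero]
    intro i hi
    simpa using hv (-i) (hmem.2 (by simpa using hi))

theorem orthonormal_of_subset (hy : IsOrderedEigensystem B I ev y) {s : Finset ℤ} (hs : s ⊆ I) :
    Orthonormal ℂ (fun i : s => y i) :=
  hy.orthonormal.comp (fun i : s => (⟨i, hs i.2⟩ : I))
    (fun _ _ h => Subtype.ext (by simpa using h))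

theorem op_apply (hy : IsOrderedEigensystem B I ev y) (v : EuclideanSpace ℂ (Fin m)) :
    op B v = ∑ i : I, ((ev i : ℂ) * inner ℂ (y i) v) • y i := by
  have h0 : op B (v - fourierSum (fun i : I => y i) v) = 0 := by
    refine hy.complete _ fun i hi => ?_
    rw [inner_sub_right, inner_fourierSum_right hy.orthonormal ⟨i, hi⟩, sub_self]
  rw [map_sub, sub_eq_zero] at h0
  rw [h0, fourierSum_apply, map_sum]
  refine Finset.sum_congr rfl fun i _ => ?_
  rw [map_smul, hy.eigen _ i.2, smul_smul, mul_comm]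

theorem re_inner_op (hy : IsOrderedEigensystem B I ev y) (v : EuclideanSpace ℂ (Fin m)) :
    (inner ℂ v (op B v) : ℂ).re = ∑ i : I, ev i * ‖(inner ℂ (y i) v : ℂ)‖ ^ 2 := by
  rw [hy.op_apply, inner_sum, Complex.re_sum]
  refine Finset.sum_congr rfl fun i _ => ?_
  rw [inner_smul_right, mul_assoc, ← inner_conj_symm v, Complex.mul_conj', Complex.re_ofReal_mul]
  norm_cast

theorem inner_eq_zero_of_mem_eigenspace (hy : IsOrderedEigensystem B I ev y) {lam : ℝ}
    {w : EuclideanSpace ℂ (Fin m)} (hw : w ∈ eigenspace B lam) {i : ℤ} (hi : i ∈ I)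
    (hne : ev i ≠ lam) : (inner ℂ (y i) w : ℂ) = 0 := by
  have h1 : (inner ℂ (y i) (op B w) : ℂ) = ev i * inner ℂ (y i) w := by
    rw [hy.op_apply]
    exact hy.orthonormal.inner_right_fintype _ (⟨i, hi⟩ : I)
  rw [mem_eigenspace.1 hw, inner_smul_right] at h1
  have h2 : ((ev i : ℂ) - lam) * inner ℂ (y i) w = 0 := by rw [sub_mul, h1, sub_self]
  exact (mul_eq_zero.1 h2).resolve_left (sub_ne_zero.2 (by exact_mod_cast hne))

/-- An eigenvector for `lam ≠ 0` lies in the range of `B`, hence in the span of the `y i`; those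
with another eigenvalue are orthogonal to it. -/
theorem starProjection_eigenspace (hy : IsOrderedEigensystem B I ev y) {lam : ℝ} (hlam : lam ≠ 0)
    (x : EuclideanSpace ℂ (Fin m)) :
    (eigenspace B lam).starProjection x
      = fourierSum (fun i : (I.filter fun i => ev i = lam : Finset ℤ) => y i) x := by
  have hs : (I.filter fun i => ev i = lam) ⊆ I := Finset.filter_subset _ _
  refine Submodule.eq_starProjection_of_mem_of_inner_eq_zero ?_ ?_
  · rw [fourierSum_apply]
    refine Submodule.sum_mem _ fun i _ => Submodule.smul_mem _ _ ?_
    rw [mem_eigenspace, hy.eigen _ (hs i.2), (Finset.mem_filter.1 i.2).2]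
  · intro w hw
    have hw' : w = (lam : ℂ)⁻¹ • ∑ i : I, ((ev i : ℂ) * inner ℂ (y i) w) • y i := by
      rw [← hy.op_apply, mem_eigenspace.1 hw, inv_smul_smul₀ (by exact_mod_cast hlam)]
    rw [hw', inner_smul_right, inner_sum, Finset.sum_eq_zero, mul_zero]
    intro i _
    by_cases hi : ev i = lam
    · have hi' : (i : ℤ) ∈ I.filter fun i => ev i = lam := Finset.mem_filter.2 ⟨i.2, hi⟩
      have := inner_fourierSum_right (hy.orthonormal_of_subset hs) ⟨i, hi'⟩ x
      rw [inner_smul_right, ← inner_conj_symm (x - _), inner_sub_right, this, sub_self, map_zero,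
        mul_zero]
    · rw [hy.inner_eq_zero_of_mem_eigenspace hw i.2 hi, mul_zero, zero_smul, inner_zero_right]

theorem card_filter_le (hy : IsOrderedEigensystem B I ev y) (lam : ℝ) :
    (I.filter fun i => ev i = lam).card ≤ multiplicity B lam := by
  have hs : (I.filter fun i => ev i = lam) ⊆ I := Finset.filter_subset _ _
  have hli := (hy.orthonormal_of_subset hs).linearIndependent
  have hli' : LinearIndependent ℂ (fun i : (I.filter fun i => ev i = lam : Finset ℤ) =>
      (⟨y i, by rw [mem_eigenspace, hy.eigen _ (hs i.2), (Finset.mem_filter.1 i.2).2]⟩ :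
        eigenspace B lam)) :=
    LinearIndependent.of_comp (eigenspace B lam).subtype hli
  simpa [multiplicity] using hli'.fintype_card_le_finrank

theorem isEigenvalue (hy : IsOrderedEigensystem B I ev y) {i : ℤ} (hi : i ∈ I) :
    IsEigenvalue B (ev i) := by
  intro h
  have : y i ∈ eigenspace B (ev i) := mem_eigenspace.2 (hy.eigen i hi)
  rw [h, Submodule.mem_bot] at this
  exact hy.orthonormal.ne_zero ⟨i, hi⟩ this

theorem mem_of_isEigenvalue (hy : IsOrderedEigensystem B I ev y) {ν : ℝ} (h : IsEigenvalue B ν) :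
    ν ∈ insert 0 (I.image ev) := by
  by_contra hν
  simp only [Finset.mem_insert, Finset.mem_image, not_or, not_exists, not_and] at hν
  refine h ((Submodule.eq_bot_iff _).2 fun w hw => ?_)
  have h0 : op B w = 0 :=
    hy.complete w fun i hi => hy.inner_eq_zero_of_mem_eigenspace hw hi (hν.2 i hi)
  rw [mem_eigenspace.1 hw] at h0
  exact (smul_eq_zero.1 h0).resolve_left (by exact_mod_cast hν.1)

theorem spectralGap_ne_zero (hy : IsOrderedEigensystem B I ev y) (lam : ℝ) :
    spectralGap B lam ≠ 0 := by
  have hfin : {ν : ℝ | IsEigenvalue B ν ∧ ν ≠ lam}.Finite :=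
    (insert 0 (I.image ev)).finite_toSet.subset fun ν hν => hy.mem_of_isEigenvalue hν.1
  rcases Set.eq_empty_or_nonempty {ν : ℝ | IsEigenvalue B ν ∧ ν ≠ lam} with h | h
  · rw [spectralGap, h]
    simp
  · obtain ⟨ν₀, hν₀, hmin⟩ := Set.exists_min_image _ (fun ν => ENNReal.ofReal |lam - ν|) hfin h
    have hpos : 0 < ENNReal.ofReal |lam - ν₀| :=
      ENNReal.ofReal_pos.2 (abs_pos.2 (sub_ne_zero.2 hν₀.2.symm))
    exact (hpos.trans_le (le_iInf₂ hmin)).ne'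

/-- The product form stays meaningful under the convention `1/∞ = 0`. The gap is nonzero because
there are only finitely many eigenvalues. -/
theorem one_le_inv_spectralGap_mul (hy : IsOrderedEigensystem B I ev y) {lam ν : ℝ}
    (hν : IsEigenvalue B ν) (hne : ν ≠ lam) :
    1 ≤ (spectralGap B lam)⁻¹.toReal * |ν - lam| := by
  have hpos : 0 < |lam - ν| := abs_pos.2 (sub_ne_zero.2 hne.symm)
  have hle : spectralGap B lam ≤ ENNReal.ofReal |lam - ν| := iInf₂_le ν ⟨hν, hne⟩
  have hfin : spectralGap B lam ≠ ∞ := ne_top_of_le_ne_top ENNReal.ofReal_ne_top hle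
  have hg : 0 < (spectralGap B lam).toReal :=
    ENNReal.toReal_pos (hy.spectralGap_ne_zero lam) hfin
  rw [ENNReal.toReal_inv, abs_sub_comm, inv_mul_eq_div, one_le_div hg]
  exact ENNReal.toReal_le_of_le_ofReal hpos.le hle

/-- A vector that is nearly an eigenvector for `lam` is close to the eigenspace. -/
theorem norm_sub_fourierSum_le_gap (hy : IsOrderedEigensystem B I ev y) {lam : ℝ}
    (hlam : lam ≠ 0) (v : EuclideanSpace ℂ (Fin m)) :
    ‖v - fourierSum (fun i : (I.filter fun i => ev i = lam : Finset ℤ) => y i) v‖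
      ≤ (spectralGap B lam)⁻¹.toReal * ‖op B v - (lam : ℂ) • v‖ := by
  set c := (spectralGap B lam)⁻¹.toReal with hc
  have hc0 : 0 ≤ c := ENNReal.toReal_nonneg
  set v₀ := v - fourierSum (fun i : I => y i) v with hv₀
  have hs : (I.filter fun i => ev i = lam) ⊆ I := Finset.filter_subset _ _
  have h1 := norm_sq_eq_fourierSum_add (hy.orthonormal_of_subset hs) v
  have h2 := norm_sq_eq_fourierSum_add hy.orthonormal v
  rw [norm_sq_fourierSum (hy.orthonormal_of_subset hs),
    Finset.sum_coe_sort _ (fun i => ‖(inner ℂ (y i) v : ℂ)‖ ^ 2), Finset.sum_filter,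
    ← Finset.sum_coe_sort] at h1
  rw [norm_sq_fourierSum hy.orthonormal] at h2
  have horth : ∀ i : I, (inner ℂ (y i) v₀ : ℂ) = 0 := fun i => by
    rw [hv₀, inner_sub_right, inner_fourierSum_right hy.orthonormal i, sub_self]
  have hres : op B v - (lam : ℂ) • v
      = (∑ i : I, (((ev i - lam : ℝ) : ℂ) * inner ℂ (y i) v) • y i) + -((lam : ℂ) • v₀) := by
    rw [hy.op_apply v, hv₀, smul_sub, fourierSum_apply, Finset.smul_sum, neg_sub, ← add_sub_assoc,
      ← Finset.sum_add_distrib]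
    congr 1
    refine Finset.sum_congr rfl fun i _ => ?_
    rw [smul_smul, ← add_smul]
    push_cast
    ring_nf
  have h3 : ‖op B v - (lam : ℂ) • v‖ ^ 2
      = ∑ i : I, (|ev i - lam| * ‖(inner ℂ (y i) v : ℂ)‖) ^ 2 + (|lam| * ‖v₀‖) ^ 2 := by
    rw [hres, norm_add_sq_of_inner_eq_zero, norm_sq_sum_smul hy.orthonormal, norm_neg, norm_smul]
    · simp only [norm_mul, Complex.norm_real, Real.norm_eq_abs]
    · rw [sum_inner]
      refine Finset.sum_eq_zero fun i _ => ?_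
      rw [inner_smul_left, inner_neg_right, inner_smul_right, horth]
      simp
  have hterm : ∀ i : I, ‖(inner ℂ (y i) v : ℂ)‖ ^ 2
      ≤ (if ev i = lam then ‖(inner ℂ (y i) v : ℂ)‖ ^ 2 else 0)
        + c ^ 2 * (|ev i - lam| * ‖(inner ℂ (y i) v : ℂ)‖) ^ 2 := by
    intro i
    split_ifs with h
    · exact le_add_of_nonneg_right (by positivity)
    · have := hy.one_le_inv_spectralGap_mul (hy.isEigenvalue i.2) h
      rw [zero_add, ← mul_pow, ← mul_assoc]
      gcongr
      exact le_mul_of_one_le_left (norm_nonneg _) this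
  -- `v₀` is the component of `v` in the kernel of `B`. If it is nonzero, then 0 is itself an
  -- eigenvalue, at distance `|lam|` from `lam`.
  have hv₀le : ‖v₀‖ ^ 2 ≤ c ^ 2 * (|lam| * ‖v₀‖) ^ 2 := by
    by_cases h0 : v₀ = 0
    · simp [h0]
    · have hev : IsEigenvalue B 0 := by
        intro hbot
        have : v₀ ∈ eigenspace B 0 := by
          rw [mem_eigenspace, hy.complete v₀ fun i hi => horth ⟨i, hi⟩]
          simp
        rw [hbot] at this
        exact h0 this
      have := hy.one_le_inv_spectralGap_mul hev hlam.symm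
      rw [zero_sub, abs_neg] at this
      rw [← mul_pow, ← mul_assoc]
      gcongr
      exact le_mul_of_one_le_left (norm_nonneg _) this
  have hsum := Finset.sum_le_sum fun i (_ : i ∈ Finset.univ) => hterm i
  rw [Finset.sum_add_distrib, ← Finset.mul_sum] at hsum
  refine abs_le_of_sq_le_sq' ?_ (by positivity) |>.2
  rw [mul_pow, h3]
  linarith

/-- The dimension count behind the min-max principle. -/
theorem exists_ne_zero_re_inner (hy : IsOrderedEigensystem B I ev y)
    (hy' : IsOrderedEigensystem B' I' ev' y')
    (R : EuclideanSpace ℂ (Fin m) →ₗ[ℂ] EuclideanSpace ℂ (Fin m'))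
    {i : ℤ} (hi : i ∈ I) (hi0 : 0 < i) {c : ℝ} (hc : 0 ≤ c)
    (hle : ∀ k ∈ I', i ≤ k → ev' k ≤ c) :
    ∃ u ≠ 0, ev i * ‖u‖ ^ 2 ≤ (inner ℂ u (op B u) : ℂ).re
      ∧ (inner ℂ (R u) (op B' (R u)) : ℂ).re ≤ c * ‖R u‖ ^ 2 := by
  have hs : Finset.Icc 1 i ⊆ I := fun k hk => by
    rw [Finset.mem_Icc] at hk
    exact hy.mem_of_le hi (by omega) hk.2
  -- There are `i` coefficients and only `i - 1` conditions, so some nonzero combination `u` of `y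
  -- 1, …, y i` has `R u` orthogonal to `y' 1, …, y' (i - 1)`. Indices outside `I'` do no harm, as
  -- only the number of conditions counts.
  let L : (Finset.Icc 1 i → ℂ) →ₗ[ℂ] (Finset.Icc 1 (i - 1) → ℂ) :=
    LinearMap.pi fun k => innerₛₗ ℂ (y' k) ∘ₗ R ∘ₗ
      Fintype.linearCombination ℂ (fun j : Finset.Icc 1 i => y j)
  have hker : LinearMap.ker L ≠ ⊥ := by
    refine LinearMap.ker_ne_bot_of_finrank_lt ?_
    simp only [Module.finrank_fintype_fun_eq_card, Fintype.card_coe, Int.card_Icc]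
    omega
  obtain ⟨a, ha, ha0⟩ := Submodule.exists_mem_ne_zero_of_ne_bot hker
  have hon := hy.orthonormal_of_subset hs
  set u := ∑ j : Finset.Icc 1 i, a j • y j with hu
  have hnorm : ‖u‖ ^ 2 = ∑ j, ‖a j‖ ^ 2 := norm_sq_sum_smul hon a
  refine ⟨u, ?_, ?_, ?_⟩
  · intro h0
    rw [h0, norm_zero, zero_pow two_ne_zero] at hnorm
    refine ha0 (funext fun j => ?_)
    have := (Finset.sum_eq_zero_iff_of_nonneg fun j _ => sq_nonneg ‖a j‖).1 hnorm.symm j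
      (Finset.mem_univ j)
    simpa using this
  · have hop : op B u = ∑ j : Finset.Icc 1 i, ((ev j : ℂ) * a j) • y j := by
      rw [hu, map_sum]
      refine Finset.sum_congr rfl fun j _ => ?_
      rw [map_smul, hy.eigen _ (hs j.2), smul_smul, mul_comm]
    rw [hop, hnorm, hu, hon.inner_sum, Complex.re_sum, Finset.mul_sum]
    refine Finset.sum_le_sum fun j _ => ?_
    have hj := Finset.mem_Icc.1 j.2
    rw [mul_left_comm, Complex.conj_mul', Complex.re_ofReal_mul, ← Complex.ofReal_pow,
      Complex.ofReal_re]
    gcongr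
    exact hy.antitone_pos _ (hs j.2) _ hi (by omega) hj.2
  · rw [hy'.re_inner_op]
    refine le_trans ?_ (mul_le_mul_of_nonneg_left
      (pow_le_pow_left₀ (norm_nonneg _) (norm_fourierSum_le hy'.orthonormal (R u)) 2) hc)
    rw [norm_sq_fourierSum hy'.orthonormal, Finset.mul_sum]
    refine Finset.sum_le_sum fun k _ => ?_
    by_cases hk : (k : ℤ) ∈ Finset.Icc 1 (i - 1)
    · have h0 : (inner ℂ (y' k) (R u) : ℂ) = 0 := congrFun (LinearMap.mem_ker.1 ha) ⟨k, hk⟩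
      simp [h0]
    · gcongr
      rcases lt_trichotomy (k : ℤ) 0 with h | h | h
      · exact (hy'.neg _ k.2 h).le.trans hc
      · exact absurd (h ▸ k.2) hy'.zero_notMem
      · refine hle _ k.2 ?_
        rw [Finset.mem_Icc] at hk
        omega

theorem re_inner_op_sub_le {B C : Matrix (Fin m) (Fin m) ℝ} (u : EuclideanSpace ℂ (Fin m)) :
    (inner ℂ u (op B u) : ℂ).re ≤ (inner ℂ u (op C u) : ℂ).re + ‖op B - op C‖ * ‖u‖ ^ 2 := by
  have h : (inner ℂ u ((op B - op C) u) : ℂ).re ≤ ‖op B - op C‖ * ‖u‖ ^ 2 :=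
    calc _ ≤ ‖u‖ * ‖(op B - op C) u‖ := re_inner_le_norm (𝕜 := ℂ) u ((op B - op C) u)
      _ ≤ ‖u‖ * (‖op B - op C‖ * ‖u‖) := by gcongr; exact (op B - op C).le_opNorm u
      _ = _ := by ring
  rw [_root_.sub_apply, inner_sub_right, Complex.sub_re] at h
  linarith

/-- Min-max with `R` the identity and `c = ev' i`: one test vector bounds both quadratic forms. -/
theorem ev_le_add {C : Matrix (Fin m) (Fin m) ℝ} {z : ℤ → EuclideanSpace ℂ (Fin m)}
    (hy : IsOrderedEigensystem B I ev y) (hz : IsOrderedEigensystem C I' ev' z)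
    {i : ℤ} (hi : i ∈ I) (hi' : i ∈ I') (hi0 : 0 < i) : ev i ≤ ev' i + ‖op B - op C‖ := by
  obtain ⟨u, hu0, h1, h2⟩ := hy.exists_ne_zero_re_inner hz LinearMap.id hi hi0
    (hz.pos i hi' hi0).le fun k hk hik => hz.antitone_pos i hi' k hk hi0 hik
  have h3 := re_inner_op_sub_le (B := B) (C := C) u
  have hu : 0 < ‖u‖ ^ 2 := pow_pos (norm_pos_iff.2 hu0) 2
  rw [LinearMap.id_apply] at h2
  refine le_of_mul_le_mul_right ?_ hu
  linarith

/-- Weyl's inequality. -/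
theorem abs_ev_sub_le {C : Matrix (Fin m) (Fin m) ℝ} {z : ℤ → EuclideanSpace ℂ (Fin m)}
    (hy : IsOrderedEigensystem B I ev y) (hz : IsOrderedEigensystem C I' ev' z)
    {i : ℤ} (hi : i ∈ I) (hi' : i ∈ I') : |ev i - ev' i| ≤ ‖op B - op C‖ := by
  rw [abs_sub_le_iff]
  have hC := norm_sub_rev (op B) (op C)
  rcases lt_trichotomy i 0 with h | h | h
  · have hm : ∀ {J : Finset ℤ}, i ∈ J → -i ∈ J.map (Equiv.neg ℤ).toEmbedding := fun h => by
      simpa [Finset.mem_map_equiv] using h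
    have h1 := hy.neg_system.ev_le_add hz.neg_system (hm hi) (hm hi') (by omega)
    have h2 := hz.neg_system.ev_le_add hy.neg_system (hm hi') (hm hi) (by omega)
    simp only [op_neg, neg_neg, neg_sub_neg] at h1 h2
    constructor <;> linarith
  · exact absurd (h ▸ hi) hy.zero_notMem
  · have h1 := hy.ev_le_add hz hi hi' h
    have h2 := hz.ev_le_add hy hi' hi h
    constructor <;> linarith

end IsOrderedEigensystem

theorem op_apply_coord {m : ℕ} (B : Matrix (Fin m) (Fin m) ℝ) (x : EuclideanSpace ℂ (Fin m))
    (i : Fin m) : op B x i = ∑ j, (B i j : ℂ) * x j := rfl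

theorem weightedMatrix_apply {n : ℕ} (A : Matrix (Fin n) (Fin n) ℝ) (μ : Fin n → ℝ)
    (i j : Fin n) : weightedMatrix A μ i j = √(μ i) * A i j * √(μ j) := by
  rw [weightedMatrix, Matrix.mul_diagonal, Matrix.diagonal_mul]

theorem inner_eq_sum {m : ℕ} (x z : EuclideanSpace ℂ (Fin m)) :
    (inner ℂ x z : ℂ) = ∑ i, (starRingEnd ℂ) (x i) * z i := by
  rw [PiLp.inner_apply]
  exact Finset.sum_congr rfl fun i _ => mul_comm _ _

/-! ### Block-constant vectors: passing between `W` and `A_μ` -/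

namespace BlockMeasure

variable {n N : ℕ} (b b' : BlockMeasure n N)

theorem size_pos (hN : 0 < N) (i : Fin n) : 0 < b.size i := by
  have h : (0 : ℝ) < b.size i := by
    rw [b.size_eq]
    exact mul_pos (b.μ_pos i) (by exact_mod_cast hN)
  exact_mod_cast h

theorem sum_blockOf {M : Type*} [AddCommMonoid M] (f : Fin n → M) :
    ∑ u, f (b.blockOf u) = ∑ i, b.size i • f i := by
  rw [← Equiv.sum_comp (finSigmaFinEquiv.trans (finCongr b.sum_size)), Fintype.sum_sigma]
  refine Finset.sum_congr rfl fun i _ => ?_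
  simp [blockOf]

/-- The isometric embedding of `ℂ^n` into `ℂ^N` as the space of vectors that are constant on
blocks. -/
noncomputable def stepEmbedding : EuclideanSpace ℂ (Fin n) →L[ℂ] EuclideanSpace ℂ (Fin N) :=
  LinearMap.toContinuousLinearMap
    { toFun := fun c => WithLp.toLp 2 fun u =>
        ((√(b.size (b.blockOf u)) : ℝ) : ℂ)⁻¹ * c (b.blockOf u)
      map_add' := fun c d => by ext u; simp [mul_add]
      map_smul' := fun a c => by ext u; simp [mul_left_comm] }

theorem stepEmbedding_apply (c : EuclideanSpace ℂ (Fin n)) (u : Fin N) :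
    b.stepEmbedding c u = ((√(b.size (b.blockOf u)) : ℝ) : ℂ)⁻¹ * c (b.blockOf u) := rfl

variable {b}

theorem sqrt_size_ne_zero (hN : 0 < N) (i : Fin n) : ((√(b.size i) : ℝ) : ℂ) ≠ 0 := by
  have : 0 < √(b.size i : ℝ) := Real.sqrt_pos.2 (by exact_mod_cast b.size_pos hN i)
  exact_mod_cast this.ne'

theorem sqrt_size_mul_self (i : Fin n) :
    ((√(b.size i) : ℝ) : ℂ) * ((√(b.size i) : ℝ) : ℂ) = (b.size i : ℂ) := by
  rw [← Complex.ofReal_mul, Real.mul_self_sqrt (Nat.cast_nonneg _), Complex.ofReal_natCast]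

theorem inner_stepEmbedding (hN : 0 < N) (c d : EuclideanSpace ℂ (Fin n)) :
    (inner ℂ (b.stepEmbedding c) (b.stepEmbedding d) : ℂ) = inner ℂ c d := by
  simp only [inner_eq_sum, stepEmbedding_apply]
  rw [b.sum_blockOf (fun i => (starRingEnd ℂ) (((√(b.size i) : ℝ) : ℂ)⁻¹ * c i)
    * (((√(b.size i) : ℝ) : ℂ)⁻¹ * d i))]
  refine Finset.sum_congr rfl fun i _ => ?_
  have h := sqrt_size_ne_zero (b := b) hN i
  rw [nsmul_eq_mul, ← sqrt_size_mul_self, map_mul, map_inv₀, Complex.conj_ofReal]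
  field_simp

theorem norm_stepEmbedding (hN : 0 < N) (c : EuclideanSpace ℂ (Fin n)) :
    ‖b.stepEmbedding c‖ = ‖c‖ := by
  rw [@norm_eq_sqrt_re_inner ℂ, @norm_eq_sqrt_re_inner ℂ, inner_stepEmbedding hN]

theorem adjoint_stepEmbedding (hN : 0 < N) (c : EuclideanSpace ℂ (Fin n)) :
    b.stepEmbedding.adjoint (b.stepEmbedding c) = c :=
  ext_inner_left ℂ fun d => by
    rw [ContinuousLinearMap.adjoint_inner_right, inner_stepEmbedding hN]

theorem norm_adjoint_stepEmbedding_le (hN : 0 < N) (x : EuclideanSpace ℂ (Fin N)) :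
    ‖b.stepEmbedding.adjoint x‖ ≤ ‖x‖ := by
  have h : ‖b.stepEmbedding.adjoint‖ ≤ 1 := by
    rw [LinearIsometryEquiv.norm_map]
    exact ContinuousLinearMap.opNorm_le_bound _ zero_le_one fun c => by
      rw [norm_stepEmbedding hN, one_mul]
  exact (b.stepEmbedding.adjoint.le_of_opNorm_le h x).trans_eq (one_mul _)

/-- Summing over block `j` turns the normalization `1/√(size j)` into `√(size j) = √(μ j) * √N`. The
output normalization supplies the remaining `√(μ i) * √N`. -/
theorem op_modelMatrix_stepEmbedding (hN : 0 < N) (A : Matrix (Fin n) (Fin n) ℝ)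
    (c : EuclideanSpace ℂ (Fin n)) :
    op (modelMatrix A b) (b.stepEmbedding c)
      = (N : ℂ) • b.stepEmbedding (op (weightedMatrix A b.μ) c) := by
  ext u
  rw [op_apply_coord, PiLp.smul_apply, stepEmbedding_apply, op_apply_coord, smul_eq_mul]
  simp only [modelMatrix, Matrix.of_apply, stepEmbedding_apply]
  rw [b.sum_blockOf (fun j => (A (b.blockOf u) j : ℂ) * (((√(b.size j) : ℝ) : ℂ)⁻¹ * c j)),
    Finset.mul_sum, Finset.mul_sum]
  refine Finset.sum_congr rfl fun j _ => ?_
  have hs : ∀ i, √(b.size i : ℝ) = √(b.μ i) * √(N : ℝ) := fun i => by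
    rw [b.size_eq, Real.sqrt_mul (b.μ_pos i).le]
  have hμ : ∀ i, ((√(b.μ i) : ℝ) : ℂ) ≠ 0 := fun i => by
    exact_mod_cast (Real.sqrt_pos.2 (b.μ_pos i)).ne'
  have hNN : ((√(N : ℝ) : ℝ) : ℂ) ≠ 0 := by
    exact_mod_cast (Real.sqrt_pos.2 (by exact_mod_cast hN : (0 : ℝ) < N)).ne'
  have hN2 : (N : ℂ) = ((√(N : ℝ) : ℝ) : ℂ) * ((√(N : ℝ) : ℝ) : ℂ) := by
    rw [← Complex.ofReal_mul, Real.mul_self_sqrt (Nat.cast_nonneg _), Complex.ofReal_natCast]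
  rw [nsmul_eq_mul, ← sqrt_size_mul_self, weightedMatrix_apply, hs, hs, hN2]
  push_cast
  have h1 := hμ j
  have h2 := hμ (b.blockOf u)
  field_simp

/-- Every row of the model matrix is constant on blocks, so it lies in the range of the embedding.
-/
theorem op_modelMatrix_eq_zero (hN : 0 < N) (A : Matrix (Fin n) (Fin n) ℝ)
    {x : EuclideanSpace ℂ (Fin N)} (hx : b.stepEmbedding.adjoint x = 0) :
    op (modelMatrix A b) x = 0 := by
  ext u
  have h : (inner ℂ (b.stepEmbedding (WithLp.toLp 2 fun j =>
      ((√(b.size j) : ℝ) : ℂ) * (A (b.blockOf u) j : ℂ))) x : ℂ) = 0 := by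
    rw [← ContinuousLinearMap.adjoint_inner_right, hx, inner_zero_right]
  rw [op_apply_coord, PiLp.zero_apply, ← h, inner_eq_sum]
  refine Finset.sum_congr rfl fun v _ => ?_
  rw [stepEmbedding_apply]
  simp only [modelMatrix, Matrix.of_apply]
  rw [inv_mul_cancel_left₀ (sqrt_size_ne_zero hN _), Complex.conj_ofReal]

end BlockMeasure

namespace IsOrderedEigensystem

variable {n N : ℕ} {A : Matrix (Fin n) (Fin n) ℝ} {b : BlockMeasure n N} {I : Finset ℤ}
  {ev : ℤ → ℝ} {y : ℤ → EuclideanSpace ℂ (Fin N)}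

theorem smul_adjoint_stepEmbedding (hN : 0 < N)
    (hy : IsOrderedEigensystem (modelMatrix A b) I ev y) {i : ℤ} (hi : i ∈ I) :
    (ev i : ℂ) • y i
      = (N : ℂ) • b.stepEmbedding (op (weightedMatrix A b.μ) (b.stepEmbedding.adjoint (y i))) := by
  rw [← hy.eigen i hi, ← BlockMeasure.op_modelMatrix_stepEmbedding hN, ← sub_eq_zero, ← map_sub]
  refine BlockMeasure.op_modelMatrix_eq_zero hN A ?_
  rw [map_sub, BlockMeasure.adjoint_stepEmbedding hN, sub_self]

theorem op_weightedMatrix_adjoint (hN : 0 < N)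
    (hy : IsOrderedEigensystem (modelMatrix A b) I ev y) {i : ℤ} (hi : i ∈ I) :
    (N : ℂ) • op (weightedMatrix A b.μ) (b.stepEmbedding.adjoint (y i))
      = (ev i : ℂ) • b.stepEmbedding.adjoint (y i) := by
  rw [← map_smul _ (ev i : ℂ), hy.smul_adjoint_stepEmbedding hN hi, map_smul,
    BlockMeasure.adjoint_stepEmbedding hN]

/-- An eigenvector for a nonzero eigenvalue lies in the range of `W`, so it is constant on blocks.
-/
theorem stepEmbedding_adjoint (hN : 0 < N)
    (hy : IsOrderedEigensystem (modelMatrix A b) I ev y) {i : ℤ} (hi : i ∈ I) :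
    b.stepEmbedding (b.stepEmbedding.adjoint (y i)) = y i := by
  have hev : (ev i : ℂ) ≠ 0 := by exact_mod_cast hy.ev_ne_zero hi
  refine smul_right_injective _ hev ?_
  beta_reduce
  rw [hy.smul_adjoint_stepEmbedding hN hi, ← map_smul b.stepEmbedding (N : ℂ),
    hy.op_weightedMatrix_adjoint hN hi, map_smul]

/-- An eigensystem of the model matrix induces one of the weighted matrix. -/
theorem weighted (hN : 0 < N) (hy : IsOrderedEigensystem (modelMatrix A b) I ev y) :
    IsOrderedEigensystem (weightedMatrix A b.μ) I (fun i => ev i / N)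
      (fun i => b.stepEmbedding.adjoint (y i)) := by
  have hN' : (0 : ℝ) < N := by exact_mod_cast hN
  have hNC : (N : ℂ) ≠ 0 := by exact_mod_cast hN.ne'
  refine ⟨hy.index, fun i hi h => div_pos (hy.pos i hi h) hN',
    fun i hi h => div_neg_of_neg_of_pos (hy.neg i hi h) hN',
    fun i hi j hj h hij => ?_, fun i hi j hj h hij => ?_, ?_, fun i hi => ?_, fun c hc => ?_⟩
  · exact div_le_div_of_nonneg_right (hy.antitone_pos i hi j hj h hij) hN'.le
  · exact div_le_div_of_nonneg_right (hy.antitone_neg i hi j hj h hij) hN'.le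
  · have h := hy.orthonormal
    rw [orthonormal_iff_ite] at h ⊢
    intro i j
    rw [← BlockMeasure.inner_stepEmbedding hN, hy.stepEmbedding_adjoint hN i.2,
      hy.stepEmbedding_adjoint hN j.2, h i j]
  · refine smul_right_injective _ hNC ?_
    beta_reduce
    rw [hy.op_weightedMatrix_adjoint hN hi, smul_smul]
    push_cast
    rw [mul_div_cancel₀ _ hNC]
  · have h := hy.complete (b.stepEmbedding c) fun i hi => by
      rw [← ContinuousLinearMap.adjoint_inner_left, hc i hi]
    rw [BlockMeasure.op_modelMatrix_stepEmbedding hN] at h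
    have h2 := (smul_eq_zero.1 h).resolve_left hNC
    rw [← BlockMeasure.adjoint_stepEmbedding (b := b) hN (op _ c), h2, map_zero]

end IsOrderedEigensystem

/-! ### Congruence by a diagonal matrix: inertia and perturbation of the norm -/

theorem op_mul {m : ℕ} (B C : Matrix (Fin m) (Fin m) ℝ) : op (B * C) = op B * op C := by
  rw [op, op, op, ← map_mul]
  congr 1
  exact Matrix.map_mul (f := Complex.ofRealHom)

theorem op_diagonal_apply {m : ℕ} (d : Fin m → ℝ) (x : EuclideanSpace ℂ (Fin m)) (i : Fin m) :
    op (Matrix.diagonal d) x i = (d i : ℂ) * x i := by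
  rw [op_apply_coord, Finset.sum_eq_single i]
  · rw [Matrix.diagonal_apply_eq]
  · intro j _ hj
    rw [Matrix.diagonal_apply_ne' _ hj, Complex.ofReal_zero, zero_mul]
  · simp

theorem inner_op_diagonal {m : ℕ} (d : Fin m → ℝ) (x z : EuclideanSpace ℂ (Fin m)) :
    (inner ℂ x (op (Matrix.diagonal d) z) : ℂ) = inner ℂ (op (Matrix.diagonal d) x) z := by
  simp only [inner_eq_sum, op_diagonal_apply, map_mul, Complex.conj_ofReal]
  exact Finset.sum_congr rfl fun i _ => by ring

theorem norm_op_diagonal_le {m : ℕ} {d : Fin m → ℝ} {C : ℝ} (hC : 0 ≤ C) (h : ∀ i, |d i| ≤ C) :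
    ‖op (Matrix.diagonal d)‖ ≤ C := by
  refine ContinuousLinearMap.opNorm_le_bound _ hC fun x => ?_
  refine abs_le_of_sq_le_sq' ?_ (by positivity) |>.2
  rw [mul_pow, EuclideanSpace.norm_sq_eq, EuclideanSpace.norm_sq_eq, Finset.mul_sum]
  refine Finset.sum_le_sum fun i _ => ?_
  rw [op_diagonal_apply, norm_mul, mul_pow, Complex.norm_real, Real.norm_eq_abs]
  gcongr
  exact h i

namespace IsOrderedEigensystem

variable {m : ℕ} {B : Matrix (Fin m) (Fin m) ℝ} {I I' : Finset ℤ} {ev ev' : ℤ → ℝ}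
  {y y' : ℤ → EuclideanSpace ℂ (Fin m)} {d : Fin m → ℝ}

/-- If `i ∉ I'`, then `I'` has no index from `i` on, so min-max applies with `c = 0`. Taking `R =
D⁻¹` makes the two quadratic forms equal at `u`: positive by `B`, nonpositive by `D B D`. -/
theorem mem_of_mem_of_pos (hd : ∀ i, d i ≠ 0) (hy : IsOrderedEigensystem B I ev y)
    (hy' : IsOrderedEigensystem (Matrix.diagonal d * B * Matrix.diagonal d) I' ev' y')
    {i : ℤ} (hi : i ∈ I) (hi0 : 0 < i) : i ∈ I' := by
  by_contra hi'
  obtain ⟨u, hu0, h1, h2⟩ := hy.exists_ne_zero_re_inner hy'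
    (op (Matrix.diagonal d⁻¹) : EuclideanSpace ℂ (Fin m) →ₗ[ℂ] EuclideanSpace ℂ (Fin m)) hi hi0
    le_rfl fun k hk hik => absurd (hy'.mem_of_le hk hi0 hik) hi'
  have hinv : op (Matrix.diagonal d) (op (Matrix.diagonal d⁻¹) u) = u := by
    ext j
    rw [op_diagonal_apply, op_diagonal_apply, Pi.inv_apply, Complex.ofReal_inv,
      mul_inv_cancel_left₀ (by exact_mod_cast hd j)]
  rw [ContinuousLinearMap.coe_coe, op_mul, op_mul, mul_assoc, mul_apply_eq_comp,
    mul_apply_eq_comp, inner_op_diagonal, hinv, zero_mul] at h2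
  have hu : 0 < ‖u‖ ^ 2 := pow_pos (norm_pos_iff.2 hu0) 2
  have := mul_pos (hy.pos i hi hi0) hu
  linarith

/-- Sylvester's law of inertia. -/
theorem mem_of_mem (hd : ∀ i, d i ≠ 0) (hy : IsOrderedEigensystem B I ev y)
    (hy' : IsOrderedEigensystem (Matrix.diagonal d * B * Matrix.diagonal d) I' ev' y')
    {i : ℤ} (hi : i ∈ I) : i ∈ I' := by
  rcases lt_trichotomy i 0 with h | h | h
  · have hneg := hy'.neg_system
    rw [← Matrix.neg_mul, ← Matrix.mul_neg] at hneg
    have := mem_of_mem_of_pos hd hy.neg_system hneg (i := -i)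
      (by simpa [Finset.mem_map_equiv] using hi) (by omega)
    simpa [Finset.mem_map_equiv] using this
  · exact absurd (h ▸ hi) hy.zero_notMem
  · exact mem_of_mem_of_pos hd hy hy' hi h

end IsOrderedEigensystem

theorem weightedMatrix_eq_mul {n : ℕ} (A : Matrix (Fin n) (Fin n) ℝ) {μ μ' e : Fin n → ℝ}
    (hμ : ∀ i, 0 ≤ μ i) (he : ∀ i, μ' i = μ i * (1 + e i)) :
    weightedMatrix A μ' = Matrix.diagonal (fun i => √(1 + e i)) * weightedMatrix A μ
      * Matrix.diagonal (fun i => √(1 + e i)) := by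
  ext i j
  rw [Matrix.mul_diagonal, Matrix.diagonal_mul, weightedMatrix_apply, weightedMatrix_apply,
    he, he, Real.sqrt_mul (hμ i), Real.sqrt_mul (hμ j)]
  ring

theorem norm_op_weightedMatrix_sub_le {n : ℕ} (A : Matrix (Fin n) (Fin n) ℝ)
    {μ μ' e : Fin n → ℝ} (hμ : ∀ i, 0 ≤ μ i) (he : ∀ i, μ' i = μ i * (1 + e i))
    {ε : ℝ} (hε0 : 0 ≤ ε) (hε : ε ≤ 1 / 3) (heε : ∀ i, |e i| ≤ ε) :
    ‖op (weightedMatrix A μ) - op (weightedMatrix A μ')‖ ≤ 2 * ε * ‖op (weightedMatrix A μ)‖ := by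
  rw [weightedMatrix_eq_mul A hμ he, op_mul, op_mul]
  set T := op (weightedMatrix A μ)
  set D := op (Matrix.diagonal fun i => √(1 + e i)) with hD
  have hsq : ∀ i, 1 / 2 ≤ √(1 + e i) ∧ √(1 + e i) ≤ 2 ∧ √(1 + e i) ^ 2 = 1 + e i := by
    intro i
    have := abs_le.1 (heε i)
    exact ⟨Real.le_sqrt_of_sq_le (by linarith), Real.sqrt_le_iff.2 ⟨by norm_num, by linarith⟩,
      Real.sq_sqrt (by linarith)⟩
  have h1 : ‖D‖ ≤ 2 := norm_op_diagonal_le zero_le_two fun i => by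
    rw [abs_of_nonneg (Real.sqrt_nonneg _)]
    exact (hsq i).2.1
  -- Here `|1 - √(1 + e)| = |e| / (1 + √(1 + e))`, and the denominator is at least `3/2`. In the end
  -- `2/3 * 2 + 2/3 = 2`.
  have h2 : ‖1 - D‖ ≤ 2 / 3 * ε := by
    have : 1 - D = op (Matrix.diagonal fun i => 1 - √(1 + e i)) := by
      ext x i
      rw [op_diagonal_apply, _root_.sub_apply, one_apply_eq_self, PiLp.sub_apply, hD,
        op_diagonal_apply]
      push_cast
      ring
    rw [this]
    refine norm_op_diagonal_le (by positivity) fun i => ?_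
    obtain ⟨ha, -, hb⟩ := hsq i
    have := abs_le.1 (heε i)
    rw [abs_le]
    constructor <;> nlinarith
  have h3 : T - D * T * D = (1 - D) * T * D + T * (1 - D) := by
    rw [sub_mul, sub_mul, mul_sub, one_mul, mul_one]
    abel
  rw [h3]
  calc _ ≤ ‖1 - D‖ * ‖T‖ * ‖D‖ + ‖T‖ * ‖1 - D‖ :=
        (norm_add_le _ _).trans (add_le_add ((norm_mul_le _ _).trans (by gcongr; exact norm_mul_le _ _))
          (norm_mul_le _ _))
    _ ≤ (2 / 3 * ε) * ‖T‖ * 2 + ‖T‖ * (2 / 3 * ε) := by gcongr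
    _ = _ := by ring

/-! ### Overlap of the blocks and the distance between the embeddings -/

namespace BlockMeasure

variable {n N : ℕ} (b b' : BlockMeasure n N)

theorem sum_castLE_eq_sum_Iio (f : Fin n → ℕ) (i : Fin n) :
    ∑ j : Fin i, f (Fin.castLE i.2.le j) = ∑ j ∈ Finset.Iio i, f j := by
  refine Finset.sum_bij (fun j _ => Fin.castLE i.2.le j) ?_ ?_ ?_ ?_
  · intro j _
    rw [Finset.mem_Iio]
    exact j.2
  · intro j _ k _ h
    exact Fin.castLE_injective _ h
  · intro k hk
    exact ⟨⟨k, Fin.lt_def.1 (Finset.mem_Iio.1 hk)⟩, Finset.mem_univ _, rfl⟩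
  · intro j _
    rfl

theorem blockOf_eq {i : Fin n} {u : Fin N} (h1 : ∑ j ∈ Finset.Iio i, b.size j ≤ u)
    (h2 : (u : ℕ) < ∑ j ∈ Finset.Iic i, b.size j) : b.blockOf u = i := by
  rw [← Finset.Iio_insert, Finset.sum_insert (by simp)] at h2
  have h : Fin.cast b.sum_size.symm u
      = finSigmaFinEquiv ⟨i, ⟨u - ∑ j ∈ Finset.Iio i, b.size j, by omega⟩⟩ := by
    ext
    rw [finSigmaFinEquiv_apply, sum_castLE_eq_sum_Iio]
    simp only [Fin.val_cast]
    omega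
  rw [blockOf, h, Equiv.symm_apply_apply]

/-- The number of vertices that lie in block `i` for both measures. -/
def overlap (i : Fin n) : ℕ :=
  (Finset.univ.filter fun u => b.blockOf u = i ∧ b'.blockOf u = i).card

/-- The blocks are intervals bounded by partial sums, so they share everything from the larger left
end to the smaller right end. The additive form also covers disjoint blocks. -/
theorem le_overlap (i : Fin n) :
    min (∑ j ∈ Finset.Iic i, b.size j) (∑ j ∈ Finset.Iic i, b'.size j)
      ≤ overlap b b' i + max (∑ j ∈ Finset.Iio i, b.size j) (∑ j ∈ Finset.Iio i, b'.size j) := by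
  rw [← tsub_le_iff_right, ← Nat.card_Ico, overlap, ← Finset.card_map Fin.valEmbedding]
  refine Finset.card_le_card fun k hk => ?_
  rw [Finset.mem_Ico, max_le_iff, lt_min_iff] at hk
  have hN : ∑ j ∈ Finset.Iic i, b.size j ≤ N :=
    (Finset.sum_le_univ_sum_of_nonneg fun _ => Nat.zero_le _).trans_eq b.sum_size
  refine Finset.mem_map.2 ⟨⟨k, hk.2.1.trans_le hN⟩, ?_, rfl⟩
  simp only [Finset.mem_filter, Finset.mem_univ, true_and]
  exact ⟨b.blockOf_eq hk.1.1 hk.2.1, b'.blockOf_eq hk.1.2 hk.2.2⟩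

variable {b b'} {e : Fin n → ℝ} {ε : ℝ}

theorem abs_sum_size_sub_le (he : ∀ i, b'.μ i = b.μ i * (1 + e i)) (heε : ∀ i, |e i| ≤ ε)
    (s : Finset (Fin n)) :
    |∑ j ∈ s, (b'.size j : ℝ) - ∑ j ∈ s, (b.size j : ℝ)| ≤ ε * N * ∑ j ∈ s, b.μ j := by
  rw [← Finset.sum_sub_distrib, Finset.mul_sum]
  refine (Finset.abs_sum_le_sum_abs _ _).trans (Finset.sum_le_sum fun j _ => ?_)
  have hμ := (b.μ_pos j).le
  rw [b.size_eq, b'.size_eq, he, show b.μ j * (1 + e j) * N - b.μ j * N = e j * (N * b.μ j) by ring,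
    abs_mul, abs_of_nonneg (by positivity : 0 ≤ (N : ℝ) * b.μ j), mul_assoc]
  gcongr
  exact heε j

/-- The left ends differ by the change in the blocks before `i`. Since both totals are `N`, the
right ends differ by the change in the blocks after `i`. Together only the mass `1 - μ i` of the
other blocks contributes. -/
theorem overlap_ge (he : ∀ i, b'.μ i = b.μ i * (1 + e i)) (heε : ∀ i, |e i| ≤ ε) (i : Fin n) :
    N * (b.μ i - ε * (1 - b.μ i)) ≤ overlap b b' i := by
  have h0 : min (∑ j ∈ Finset.Iic i, (b.size j : ℝ)) (∑ j ∈ Finset.Iic i, (b'.size j : ℝ))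
      ≤ overlap b b' i
        + max (∑ j ∈ Finset.Iio i, (b.size j : ℝ)) (∑ j ∈ Finset.Iio i, (b'.size j : ℝ)) := by
    exact_mod_cast le_overlap b b' i
  have hsplit : ∀ f : Fin n → ℝ, ∑ j ∈ Finset.Iic i, f j = f i + ∑ j ∈ Finset.Iio i, f j := by
    intro f
    rw [← Finset.Iio_insert, Finset.sum_insert (by simp)]
  have hcompl : ∀ f : Fin n → ℝ,
      ∑ j ∈ Finset.Iic i, f j + ∑ j ∈ (Finset.Iic i)ᶜ, f j = ∑ j, f j :=
    fun f => Finset.sum_add_sum_compl _ f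
  have hN : ∀ c : BlockMeasure n N, ∑ j, (c.size j : ℝ) = N := fun c => by
    exact_mod_cast c.sum_size
  have h1 := abs_le.1 (abs_sum_size_sub_le he heε (Finset.Iio i))
  have h2 := abs_le.1 (abs_sum_size_sub_le he heε (Finset.Iic i)ᶜ)
  have h3 := hcompl fun j => (b.size j : ℝ)
  have h4 := hcompl fun j => (b'.size j : ℝ)
  rw [hN] at h3 h4
  have h5 := hcompl b.μ
  rw [b.μ_sum] at h5
  have h6 := hsplit b.μ
  have h7 := hsplit fun j => (b.size j : ℝ)
  rw [b.size_eq] at h7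
  have hε0 : 0 ≤ ε := (abs_nonneg _).trans (heε i)
  have hp : ∀ s : Finset (Fin n), 0 ≤ ε * N * ∑ j ∈ s, b.μ j := fun s =>
    mul_nonneg (by positivity) (Finset.sum_nonneg fun j _ => (b.μ_pos j).le)
  have hp1 := hp (Finset.Iio i)
  have hp2 := hp (Finset.Iic i)ᶜ
  have hmin : ∑ j ∈ Finset.Iic i, (b.size j : ℝ) - ε * N * ∑ j ∈ (Finset.Iic i)ᶜ, b.μ j
      ≤ min (∑ j ∈ Finset.Iic i, (b.size j : ℝ)) (∑ j ∈ Finset.Iic i, (b'.size j : ℝ)) :=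
    le_min (by linarith) (by linarith)
  have hmax : max (∑ j ∈ Finset.Iio i, (b.size j : ℝ)) (∑ j ∈ Finset.Iio i, (b'.size j : ℝ))
      ≤ ∑ j ∈ Finset.Iio i, (b.size j : ℝ) + ε * N * ∑ j ∈ Finset.Iio i, b.μ j :=
    max_le (by linarith) (by linarith)
  have h8 : ε * N * ∑ j ∈ (Finset.Iic i)ᶜ, b.μ j + ε * N * ∑ j ∈ Finset.Iio i, b.μ j
      = ε * N * (1 - b.μ i) := by
    rw [← mul_add]
    congr 1
    linarith
  linarith

theorem inner_stepEmbedding_single (i : Fin n) :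
    (inner ℂ (b.stepEmbedding (EuclideanSpace.single i 1))
        (b'.stepEmbedding (EuclideanSpace.single i 1)) : ℂ)
      = ((overlap b b' i / (√(b.size i) * √(b'.size i)) : ℝ) : ℂ) := by
  have h : ∀ u, (starRingEnd ℂ) (b.stepEmbedding (EuclideanSpace.single i 1) u)
      * b'.stepEmbedding (EuclideanSpace.single i 1) u
      = if b.blockOf u = i ∧ b'.blockOf u = i
        then (((√(b.size i) * √(b'.size i))⁻¹ : ℝ) : ℂ) else 0 := by
    intro u
    rw [stepEmbedding_apply, stepEmbedding_apply, PiLp.single_apply, PiLp.single_apply]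
    by_cases h1 : b.blockOf u = i
    · by_cases h2 : b'.blockOf u = i
      · simp [h1, h2, mul_comm]
      · simp [h2]
    · simp [h1]
  rw [inner_eq_sum, Finset.sum_congr rfl fun u _ => h u, ← Finset.sum_filter, Finset.sum_const,
    nsmul_eq_mul, overlap]
  push_cast
  rfl

theorem norm_stepEmbedding_single_sub_sq_le (hN : 0 < N)
    (he : ∀ i, b'.μ i = b.μ i * (1 + e i)) (heε : ∀ i, |e i| ≤ ε) (i : Fin n) :
    ‖(b.stepEmbedding - b'.stepEmbedding) (EuclideanSpace.single i 1)‖ ^ 2 ≤ 2 * (ε / b.μ i) := by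
  have hN' : (0 : ℝ) < N := by exact_mod_cast hN
  have hμ := b.μ_pos i
  have hε0 : 0 ≤ ε := (abs_nonneg _).trans (heε i)
  rw [_root_.sub_apply, @norm_sub_sq ℂ, norm_stepEmbedding hN, norm_stepEmbedding hN,
    inner_stepEmbedding_single]
  simp only [PiLp.norm_single, norm_one, one_pow]
  have hre : RCLike.re ((overlap b b' i / (√(b.size i) * √(b'.size i)) : ℝ) : ℂ)
      = (overlap b b' i / (√(b.size i) * √(b'.size i)) : ℝ) := Complex.ofReal_re _
  rw [hre]
  suffices h : 1 - ε / b.μ i ≤ overlap b b' i / (√(b.size i) * √(b'.size i)) by linarith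
  -- If `μ i ≤ ε` the lower bound is nonpositive. Otherwise the overlap bound suffices, as `(μ i -
  -- ε)(1 + ε) ≤ μ i - ε(1 - μ i)`.
  rcases le_total (b.μ i) ε with hle | hle
  · exact (sub_nonpos.2 ((one_le_div hμ).2 hle)).trans (by positivity)
  · have h1e : 0 < 1 + e i := by
      have := b'.μ_pos i
      rw [he] at this
      exact (mul_pos_iff_of_pos_left hμ).1 this
    have hprod : √(b.size i : ℝ) * √(b'.size i : ℝ) = b.μ i * N * √(1 + e i) := by
      rw [← Real.sqrt_mul (Nat.cast_nonneg _), b.size_eq, b'.size_eq, he,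
        show b.μ i * N * (b.μ i * (1 + e i) * N) = (b.μ i * N) ^ 2 * (1 + e i) by ring,
        Real.sqrt_mul (sq_nonneg _), Real.sqrt_sq (by positivity)]
    have hsqrt : √(1 + e i) ≤ 1 + ε := by
      have := (abs_le.1 (heε i)).2
      exact Real.sqrt_le_iff.2 ⟨by positivity, by nlinarith⟩
    rw [hprod, le_div_iff₀ (mul_pos (mul_pos hμ hN') (Real.sqrt_pos.2 h1e))]
    refine le_trans ?_ (overlap_ge he heε i)
    have h1 : (1 - ε / b.μ i) * (b.μ i * N * √(1 + e i)) = N * ((b.μ i - ε) * √(1 + e i)) := by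
      field_simp
    rw [h1]
    gcongr
    calc (b.μ i - ε) * √(1 + e i) ≤ (b.μ i - ε) * (1 + ε) := by
          gcongr
      _ ≤ _ := by nlinarith

/-- Cauchy–Schwarz over the basis vectors, a Hilbert–Schmidt bound, produces the factor `n`. The 3
is slack for the 2 of the single-block estimate. -/
theorem norm_stepEmbedding_sub_le (hn : 0 < n) (hN : 0 < N)
    (he : ∀ i, b'.μ i = b.μ i * (1 + e i)) (heε : ∀ i, |e i| ≤ ε) :
    ‖b.stepEmbedding - b'.stepEmbedding‖ ≤ √3 / √(⨅ i, b.μ i) * √(n * ε) := by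
  have : Nonempty (Fin n) := ⟨⟨0, hn⟩⟩
  have hε0 : 0 ≤ ε := (abs_nonneg _).trans (heε ⟨0, hn⟩)
  have hmin : 0 < ⨅ i, b.μ i := by
    obtain ⟨i, hi⟩ := exists_eq_ciInf_of_finite (f := b.μ)
    rw [← hi]
    exact b.μ_pos i
  refine ContinuousLinearMap.opNorm_le_bound _ (by positivity) fun c => ?_
  have hc : c = ∑ i, c i • EuclideanSpace.single i (1 : ℂ) := by
    ext j
    simp [Finset.sum_apply, Pi.single_apply]
  refine abs_le_of_sq_le_sq' ?_ (by positivity) |>.2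
  calc ‖(b.stepEmbedding - b'.stepEmbedding) c‖ ^ 2
      = ‖∑ i, c i • (b.stepEmbedding - b'.stepEmbedding) (EuclideanSpace.single i 1)‖ ^ 2 := by
        conv_lhs => rw [hc, map_sum]
        simp only [map_smul]
    _ ≤ (∑ i, ‖c i‖ ^ 2)
        * ∑ i, ‖(b.stepEmbedding - b'.stepEmbedding) (EuclideanSpace.single i 1)‖ ^ 2 :=
        norm_sum_smul_sq_le _ _
    _ ≤ (∑ i, ‖c i‖ ^ 2) * ∑ _i : Fin n, 3 * (ε / ⨅ i, b.μ i) := by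
        gcongr with i _
        refine (norm_stepEmbedding_single_sub_sq_le hN he heε i).trans ?_
        have hμ := b.μ_pos i
        gcongr
        · norm_num
        · exact ciInf_le (Set.finite_range _).bddBelow i
    _ = _ := by
        rw [← EuclideanSpace.norm_sq_eq, mul_pow, mul_pow, div_pow, Real.sq_sqrt zero_le_three,
          Real.sq_sqrt hmin.le, Real.sq_sqrt (by positivity), Finset.sum_const, Finset.card_univ,
          Fintype.card_fin, nsmul_eq_mul]
        ring

end BlockMeasure

/-! ### Assembling the estimate -/

theorem fourierSum_map {ι E F : Type*} [Fintype ι] [NormedAddCommGroup E] [InnerProductSpace ℂ E]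
    [CompleteSpace E] [NormedAddCommGroup F] [InnerProductSpace ℂ F] [CompleteSpace F]
    (J : E →L[ℂ] F) (v : ι → E) (x : F) :
    fourierSum (fun i => J (v i)) x = J (fourierSum v (J.adjoint x)) := by
  simp only [fourierSum_apply, map_sum, map_smul, ContinuousLinearMap.adjoint_inner_right]

/-- The Fourier projection is stable under a perturbation of the weighted matrix (first summand)
and of the blocks (second summand). -/
theorem norm_fourierProjection_sub_le {n N : ℕ} (hN : 0 < N) {A : Matrix (Fin n) (Fin n) ℝ}
    {b b' : BlockMeasure n N} {I I' : Finset ℤ} {ev ev' : ℤ → ℝ}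
    {y y' : ℤ → EuclideanSpace ℂ (Fin N)}
    (hy : IsOrderedEigensystem (modelMatrix A b) I ev y)
    (hy' : IsOrderedEigensystem (modelMatrix A b') I' ev' y')
    {lam : ℝ} (hlam : lam ≠ 0) (hsub : (I.filter fun i => ev i = N * lam) ⊆ I')
    (x : EuclideanSpace ℂ (Fin N)) :
    ‖fourierProjection A b lam x
        - fourierSum (fun i : (I.filter fun i => ev i = N * lam : Finset ℤ) => y' i) x‖
      ≤ (√2 * √(multiplicity (weightedMatrix A b.μ) lam)
            * ((spectralGap (weightedMatrix A b.μ) lam)⁻¹.toReal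
              * (2 * ‖op (weightedMatrix A b.μ) - op (weightedMatrix A b'.μ)‖))
          + 2 * ‖b.stepEmbedding - b'.stepEmbedding‖) * ‖x‖ := by
  have hN0 : (N : ℝ) ≠ 0 := by exact_mod_cast hN.ne'
  have hz := hy.weighted hN
  have hz' := hy'.weighted hN
  set B := weightedMatrix A b.μ
  set B' := weightedMatrix A b'.μ
  set δ := ‖op B - op B'‖
  set z := fun i => b.stepEmbedding.adjoint (y i)
  set z' := fun i => b'.stepEmbedding.adjoint (y' i)
  have hfilter : (I.filter fun i => ev i = N * lam) = I.filter fun i => ev i / N = lam :=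
    Finset.filter_congr fun i _ => by rw [div_eq_iff hN0, mul_comm]
  rw [fourierProjection, hy.starProjection_eigenspace (mul_ne_zero hN0 hlam)]
  set s := I.filter fun i => ev i = N * lam with hs
  have hsI : s ⊆ I := Finset.filter_subset _ _
  have hon := hz.orthonormal_of_subset hsI
  have hon' := hz'.orthonormal_of_subset hsub
  have hgap := fun v => hz.norm_sub_fourierSum_le_gap hlam v
  have hcard := hz.card_filter_le lam
  rw [← hfilter] at hgap hcard
  have e1 : fourierSum (fun i : s => y i) x
      = b.stepEmbedding (fourierSum (fun i : s => z i) (b.stepEmbedding.adjoint x)) := by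
    rw [← fourierSum_map]
    congr
    exact funext fun i => (hy.stepEmbedding_adjoint hN (hsI i.2)).symm
  have e2 : fourierSum (fun i : s => y' i) x
      = b'.stepEmbedding (fourierSum (fun i : s => z' i) (b'.stepEmbedding.adjoint x)) := by
    rw [← fourierSum_map]
    congr
    exact funext fun i => (hy'.stepEmbedding_adjoint hN (hsub i.2)).symm
  -- The residual of `z' i` is `(B - B') z' i` plus the eigenvalue shift times `z' i`. Each has norm
  -- at most `δ`, the second by Weyl, hence `2 * δ`.
  have hτ : ∀ i : s, ‖z' i - fourierSum (fun i : s => z i) (z' i)‖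
      ≤ (spectralGap B lam)⁻¹.toReal * (2 * δ) := by
    intro i
    refine (hgap (z' i)).trans (mul_le_mul_of_nonneg_left ?_ ENNReal.toReal_nonneg)
    have hi : ev i / N = lam := by
      rw [(Finset.mem_filter.1 i.2).2, mul_div_cancel_left₀ _ hN0]
    have hweyl : |ev i / N - ev' i / N| ≤ δ := hz.abs_ev_sub_le hz' (hsI i.2) (hsub i.2)
    rw [hi, abs_sub_comm] at hweyl
    have hone : ‖z' i‖ = 1 := hon'.1 i
    have hsplit : op B (z' i) - (lam : ℂ) • z' i
        = (op B - op B') (z' i) + ((ev' i / N - lam : ℝ) : ℂ) • z' i := by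
      rw [_root_.sub_apply, hz'.eigen i (hsub i.2)]
      push_cast
      rw [sub_smul]
      abel
    rw [hsplit]
    refine (norm_add_le _ _).trans ?_
    have h1 : ‖(op B - op B') (z' i)‖ ≤ δ := by
      simpa [hone] using (op B - op B').le_opNorm (z' i)
    have h2 : ‖((ev' i / N - lam : ℝ) : ℂ) • z' i‖ ≤ δ := by
      rwa [norm_smul, hone, mul_one, Complex.norm_real]
    linarith
  have hDK := norm_fourierSum_sub_le hon hon' (by positivity) hτ (b.stepEmbedding.adjoint x)
  rw [Fintype.card_coe] at hDK
  have hadj : ‖(b.stepEmbedding - b'.stepEmbedding).adjoint x‖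
      ≤ ‖b.stepEmbedding - b'.stepEmbedding‖ * ‖x‖ := by
    have := (b.stepEmbedding - b'.stepEmbedding).adjoint.le_opNorm x
    rwa [LinearIsometryEquiv.norm_map] at this
  rw [e1, e2]
  have hsum : b.stepEmbedding (fourierSum (fun i : s => z i) (b.stepEmbedding.adjoint x))
        - b'.stepEmbedding (fourierSum (fun i : s => z' i) (b'.stepEmbedding.adjoint x))
      = b.stepEmbedding (fourierSum (fun i : s => z i) (b.stepEmbedding.adjoint x)
          - fourierSum (fun i : s => z' i) (b.stepEmbedding.adjoint x))
        + b.stepEmbedding (fourierSum (fun i : s => z' i)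
          ((b.stepEmbedding - b'.stepEmbedding).adjoint x))
        + (b.stepEmbedding - b'.stepEmbedding)
          (fourierSum (fun i : s => z' i) (b'.stepEmbedding.adjoint x)) := by
    simp only [map_sub, _root_.sub_apply]
    abel
  rw [hsum]
  refine (norm_add₃_le).trans ?_
  rw [BlockMeasure.norm_stepEmbedding hN, BlockMeasure.norm_stepEmbedding hN]
  have t1 : ‖fourierSum (fun i : s => z i) (b.stepEmbedding.adjoint x)
      - fourierSum (fun i : s => z' i) (b.stepEmbedding.adjoint x)‖
      ≤ √2 * √(multiplicity B lam) * ((spectralGap B lam)⁻¹.toReal * (2 * δ)) * ‖x‖ := by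
    refine hDK.trans ?_
    gcongr
    exact BlockMeasure.norm_adjoint_stepEmbedding_le hN x
  have t2 := (norm_fourierSum_le hon' ((b.stepEmbedding - b'.stepEmbedding).adjoint x)).trans hadj
  have t3 : ‖(b.stepEmbedding - b'.stepEmbedding)
      (fourierSum (fun i : s => z' i) (b'.stepEmbedding.adjoint x))‖
      ≤ ‖b.stepEmbedding - b'.stepEmbedding‖ * ‖x‖ := by
    refine (ContinuousLinearMap.le_opNorm _ _).trans ?_
    gcongr
    exact (norm_fourierSum_le hon' _).trans (BlockMeasure.norm_adjoint_stepEmbedding_le hN x)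
  linarith

end SBM

theorem mainTheorem1 {n N : ℕ} (A : Matrix (Fin n) (Fin n) ℝ) (hA : A.IsSymm)
    (hA01 : ∀ i j, A i j ∈ Set.Icc (0 : ℝ) 1)
    (b b' : SBM.BlockMeasure n N) (ε : ℝ) (e : Fin n → ℝ)
    (he : ∀ i, b'.μ i = b.μ i * (1 + e i)) (heε : ∀ i, |e i| ≤ ε)
    (I I' : Finset ℤ) (ev ev' : ℤ → ℝ) (y y' : ℤ → EuclideanSpace ℂ (Fin N))
    (hy : SBM.IsOrderedEigensystem (SBM.modelMatrix A b) I ev y)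
    (hy' : SBM.IsOrderedEigensystem (SBM.modelMatrix A b') I' ev' y')
    (lam : ℝ) (hlam0 : lam ≠ 0) (hlam : SBM.IsEigenvalue (SBM.weightedMatrix A b.μ) lam) :
    (∀ i ∈ I, ev i = N * lam → i ∈ I') ∧
    ∀ x : EuclideanSpace ℂ (Fin N),
      ‖SBM.fourierProjection A b lam x
          - ∑ i ∈ I with ev i = N * lam, (inner ℂ (y' i) x : ℂ) • y' i‖
        ≤ ((2 : ℝ) ^ (5 / 2 : ℝ) * √(SBM.multiplicity (SBM.weightedMatrix A b.μ) lam : ℝ)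
              * ‖SBM.op (SBM.weightedMatrix A b.μ)‖
              * (SBM.spectralGap (SBM.weightedMatrix A b.μ) lam)⁻¹.toReal * (n * ε)
            + 2 * √3 / √(⨅ i, b.μ i) * √(n * ε)) * ‖x‖ := by
  rcases Nat.eq_zero_or_pos N with rfl | hN
  · have hI : ∀ i, i ∉ I := fun i hi =>
      hy.orthonormal.ne_zero ⟨i, hi⟩ (Subsingleton.elim _ _)
    refine ⟨fun i hi => absurd hi (hI i), fun x => ?_⟩
    rw [Subsingleton.elim (SBM.fourierProjection A b lam x - _) 0, Subsingleton.elim x 0, norm_zero,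
      mul_zero]
  have hn : 0 < n := by
    rcases Nat.eq_zero_or_pos n with rfl | h
    · simpa using b.μ_sum
    · exact h
  have hn1 : (1 : ℝ) ≤ n := by exact_mod_cast hn
  have : Nonempty (Fin n) := ⟨⟨0, hn⟩⟩
  have hε0 : 0 ≤ ε := (abs_nonneg _).trans (heε ⟨0, hn⟩)
  have hεn : ε ≤ n * ε := le_mul_of_one_le_left hε0 hn1
  have hμ := fun i => (b.μ_pos i).le
  have h1e : ∀ i, 0 < 1 + e i := fun i => by
    have := b'.μ_pos i
    rw [he] at this
    exact (mul_pos_iff_of_pos_left (b.μ_pos i)).1 this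
  have hz' := hy'.weighted hN
  rw [SBM.weightedMatrix_eq_mul A hμ he] at hz'
  have hsubset : ∀ i ∈ I, i ∈ I' := fun i hi =>
    (hy.weighted hN).mem_of_mem (fun j => (Real.sqrt_pos.2 (h1e j)).ne') hz' hi
  refine ⟨fun i hi _ => hsubset i hi, fun x => ?_⟩
  have hsub : (I.filter fun i => ev i = N * lam) ⊆ I' := fun i hi =>
    hsubset i (Finset.mem_filter.1 hi).1
  rw [← Finset.sum_coe_sort, ← SBM.fourierSum_apply (fun i :
    (I.filter fun i => ev i = N * lam : Finset ℤ) => y' i)]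
  -- For `n * ε ≥ 1/3` the second summand alone is at least 2, and a difference of two projections
  -- has norm at most 2.
  rcases le_total (n * ε) (1 / 3) with hsmall | hlarge
  · refine (SBM.norm_fourierProjection_sub_le hN hy hy' hlam0 hsub x).trans ?_
    have hδ := SBM.norm_op_weightedMatrix_sub_le A hμ he hε0 (hεn.trans hsmall) heε
    have hJ := SBM.BlockMeasure.norm_stepEmbedding_sub_le hn hN he heε
    -- The factors are `√2` from comparing projections, 2 from the residual and 2 from perturbing
    -- `A_μ`.
    have h52 : (2 : ℝ) ^ (5 / 2 : ℝ) = √2 * 4 := by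
      rw [Real.sqrt_eq_rpow, show (4 : ℝ) = 2 ^ (2 : ℝ) by norm_num, ← Real.rpow_add two_pos]
      norm_num
    rw [h52]
    gcongr ?_ * ‖x‖
    set T := ‖SBM.op (SBM.weightedMatrix A b.μ)‖
    set c := (SBM.spectralGap (SBM.weightedMatrix A b.μ) lam)⁻¹.toReal
    have hc : 0 ≤ c := ENNReal.toReal_nonneg
    have hT : 0 ≤ T := norm_nonneg _
    refine add_le_add ?_ ?_
    · calc _ ≤ √2 * √(SBM.multiplicity (SBM.weightedMatrix A b.μ) lam : ℝ)
            * (c * (2 * (2 * (n * ε) * T))) := by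
            gcongr
            exact hδ.trans (by gcongr)
        _ = _ := by ring
    · calc _ ≤ 2 * (√3 / √(⨅ i, b.μ i) * √(n * ε)) := by gcongr
        _ = _ := by ring
  · have h2 : ‖SBM.fourierProjection A b lam x - SBM.fourierSum (fun i :
        (I.filter fun i => ev i = N * lam : Finset ℤ) => y' i) x‖ ≤ 2 * ‖x‖ := by
      refine (norm_sub_le _ _).trans ?_
      have h3 := SBM.norm_fourierSum_le (hy'.orthonormal_of_subset hsub) x
      have h4 : ‖SBM.fourierProjection A b lam x‖ ≤ ‖x‖ :=
        Submodule.norm_starProjection_apply_le _ x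
      linarith
    refine h2.trans ?_
    gcongr ?_ * ‖x‖
    have hmin0 : 0 < ⨅ i, b.μ i := by
      obtain ⟨i, hi⟩ := exists_eq_ciInf_of_finite (f := b.μ)
      rw [← hi]
      exact b.μ_pos i
    have hmin1 : ⨅ i, b.μ i ≤ 1 :=
      (ciInf_le (Set.finite_range _).bddBelow ⟨0, hn⟩).trans
        ((Finset.single_le_sum (fun j _ => hμ j) (Finset.mem_univ _)).trans_eq b.μ_sum)
    have h5 : 1 ≤ √3 * √(n * ε) := by
      rw [← Real.sqrt_mul zero_le_three]
      exact Real.one_le_sqrt.2 (by linarith)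
    have h6 : 2 ≤ 2 * √3 / √(⨅ i, b.μ i) * √(n * ε) := by
      rw [div_mul_eq_mul_div, le_div_iff₀ (Real.sqrt_pos.2 hmin0)]
      have : √(⨅ i, b.μ i) ≤ 1 := Real.sqrt_le_one.2 hmin1
      linarith
    exact h6.trans (le_add_of_nonneg_left (by positivity))
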